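/- Let $X_1, X_2, \dots$ be i.i.d. real random variables with law $\mu$, and suppose that the support of $\mu$ is $[A,B]$ with $-\infty<A<B<\infty$. For each $n$, let $X_{(1)}\le\dots\le X_{(n)}$ be the ordered sample $X_1,\dots,X_n$ and put $$\underline K_1 = n\max_{1\le i\le n-1}\,(X_{(i+1)}-X_{(i)})$$ (with $\underline K_1=0$ if $n=1$). For $K\ge \underline K_1$ let $\widehat G^\star_K:[0,1]\to\mathbb R$ be the piecewise linear function $$\widehat G^\star_K(u)=\begin{cases} X_{(1)} & u\in\big[0,\tfrac1n-\tfrac{X_{(2)}-X_{(1)}}{2K}\big],\\ X_{(i)}+K\big(u-\tfrac in+\tfrac{X_{(i+1)}-X_{(i)}}{2K}\big) & u\in\big[\tfrac in-\tfrac{X_{(i+1)}-X_{(i)}}{2K},\tfrac in+\tfrac{X_{(i+1)}-X_{(i)}}{2K}\big],\ 1\le i\le n-1,\\ X_{(i+1)} & u\in\big[\tfrac in+\tfrac{X_{(i+1)}-X_{(i)}}{2K},\tfrac{i+1}n-\tfrac{X_{(i+2)}-X_{(i+1)}}{2K}\big],\ 1\le i\le n-2,\\ X_{(n)} & u\in\big[\tfrac{n-1}n+\tfrac{X_{(n)}-X_{(n-1)}}{2K},1\big],\end{cases}$$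 (the constant $X_{(1)}$ if $n=1$ or $K=0$; in the latter case all sample points coincide). Let $\widehat G^\star_{K\sharp U}$ be the law of $\widehat G^\star_K(U)$ for $U$ uniform on $[0,1]$, and let $W_1(\pi_1,\pi_2)=\inf_\pi\int|x-y|\,d\pi(x,y)$ be the $1$-Wasserstein distance, the infimum being over all couplings $\pi$ of $\pi_1$ and $\pi_2$. 1. If $\mu$ has a density on $[A,B]$ that is strictly positive and continuously differentiable on $[A,B]$ and attains its minimum over $[A,B]$ at exactly one point, then $1/\underline K_1=O((\log n)^{-1})$ almost surely: there is a deterministic constant $C$ such that, almost surely, $\underline K_1>0$ and $1/\underline K_1\le C/\log n$ for all sufficiently large $n$. 2. For every (possibly random, sample-dependent) sequence $K=K_n$ with $K_n\ge\underline K_1$ almost surely for every $n \ge 1$, $W_1(\widehat G^\star_{K_n\sharp U},\mu)=O(n^{-1/2})$ in probability: for every $\varepsilon>0$ there is $M$ such that $\mathbb P\big(W_1(\widehat G^\star_{K_n\sharp U},\mu)>M n^{-1/2}\big)\le\varepsilon$ for all sufficiently large $n$. -/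

import Mathlib

open MeasureTheory ProbabilityTheory Filter Topology Set
open scoped ENNReal

namespace WGAN

noncomputable section

/-- The order statistic `X_(i)` (with `1 ≤ i ≤ n`) of the sample `x 0, …, x (n-1)`. Indices below `1`
(above `n`) are read as `1` (as `n`); the value for an empty sample is irrelevant. -/
def orderStat {n : ℕ} (x : Fin n → ℝ) (i : ℕ) : ℝ :=
  if h : n = 0 then 0
  else x (Tuple.sort x ⟨min (i - 1) (n - 1), by omega⟩)

/-- The spacing `X_(i+1) - X_(i)`. -/
def spacing {n : ℕ} (x : Fin n → ℝ) (i : ℕ) : ℝ :=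
  orderStat x (i + 1) - orderStat x i

/-- `n * max_{i = 1, …, n-1} (X_(i+1) - X_(i))` (equal to `0` if `n ≤ 1`: the maximum of an
empty family of spacings is read as `0`). -/
def lowerK {n : ℕ} (x : Fin n → ℝ) : ℝ :=
  n * ⨆ i : Fin (n - 1), spacing x (i + 1)

/-- Left end `i/n - (X_(i+1) - X_(i)) / (2K)` of the `i`-th ramp. -/
def rampLeft {n : ℕ} (x : Fin n → ℝ) (K : ℝ) (i : ℕ) : ℝ :=
  (i : ℝ) / n - spacing x i / (2 * K)

/-- Right end `i/n + (X_(i+1) - X_(i)) / (2K)` of the `i`-th ramp. -/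
def rampRight {n : ℕ} (x : Fin n → ℝ) (K : ℝ) (i : ℕ) : ℝ :=
  (i : ℝ) / n + spacing x i / (2 * K)

open Classical in
/-- The piecewise linear generator `Ĝ*_K`, considered for `u ∈ [0,1]` and `K ≥ lowerK x`.
For such `K` the pieces agree where they overlap, so that the order of the cases and the choice
of `i` do not matter (see `gStar_first`, `gStar_ramp`, `gStar_plateau`, `gStar_last`). If `K = 0`
then all sample points coincide and the function is constant. -/
def gStar {n : ℕ} (x : Fin n → ℝ) (K u : ℝ) : ℝ :=
  if u ≤ rampLeft x K 1 then orderStat x 1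
  else if h : ∃ i, (1 ≤ i ∧ i + 1 ≤ n) ∧ u ∈ Icc (rampLeft x K i) (rampRight x K i) then
    orderStat x (Nat.find h) + K * (u - rampLeft x K (Nat.find h))
  else if h : ∃ i, (1 ≤ i ∧ i + 2 ≤ n) ∧ u ∈ Icc (rampRight x K i) (rampLeft x K (i + 1)) then
    orderStat x (Nat.find h + 1)
  else orderStat x n

/-! The pieces of `gStar` agree where they overlap. -/

theorem orderStat_mono {n : ℕ} (x : Fin n → ℝ) {i j : ℕ} (h : i ≤ j) :
    orderStat x i ≤ orderStat x j := by
  unfold orderStat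
  split_ifs with h0
  · exact le_rfl
  · apply Tuple.monotone_sort x
    simp only [Fin.mk_le_mk]
    omega

theorem spacing_nonneg {n : ℕ} (x : Fin n → ℝ) (i : ℕ) : 0 ≤ spacing x i :=
  sub_nonneg.2 (orderStat_mono x (Nat.le_succ i))

theorem mul_spacing_le {n : ℕ} (x : Fin n → ℝ) {i : ℕ} (h1 : 1 ≤ i) (h2 : i + 1 ≤ n) :
    n * spacing x i ≤ lowerK x := by
  unfold lowerK
  apply mul_le_mul_of_nonneg_left _ (Nat.cast_nonneg n)
  have := le_ciSup (f := fun i : Fin (n - 1) => spacing x (i + 1)) (Set.finite_range _).bddAbove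
    ⟨i - 1, by omega⟩
  simpa [Nat.sub_add_cancel h1] using this

theorem lowerK_nonneg {n : ℕ} (x : Fin n → ℝ) : 0 ≤ lowerK x :=
  mul_nonneg (Nat.cast_nonneg n) (Real.iSup_nonneg fun _ => spacing_nonneg x _)

theorem mul_halfWidth {n : ℕ} (x : Fin n → ℝ) {K : ℝ} (hK : lowerK x ≤ K) {i : ℕ}
    (h1 : 1 ≤ i) (h2 : i + 1 ≤ n) : K * (spacing x i / (2 * K)) = spacing x i / 2 := by
  have hs := spacing_nonneg x i
  have hn : (0 : ℝ) < n := by exact_mod_cast (by omega : 0 < n)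
  have h := (mul_spacing_le x h1 h2).trans hK
  rcases eq_or_ne K 0 with rfl | hK0
  · have : spacing x i = 0 := by nlinarith
    simp [this]
  · field_simp

theorem halfWidth_le {n : ℕ} (x : Fin n → ℝ) {K : ℝ} (hK : lowerK x ≤ K) {i : ℕ}
    (h1 : 1 ≤ i) (h2 : i + 1 ≤ n) : spacing x i / (2 * K) ≤ 1 / (2 * n) := by
  have hn : (0 : ℝ) < n := by exact_mod_cast (by omega : 0 < n)
  have h := (mul_spacing_le x h1 h2).trans hK
  rcases ((lowerK_nonneg x).trans hK).eq_or_lt with h0 | h0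
  · rw [← h0]
    simp
  · rw [div_le_div_iff₀ (by positivity) (by positivity)]
    nlinarith

theorem rampLeft_le_rampRight {n : ℕ} (x : Fin n → ℝ) {K : ℝ} (hK : lowerK x ≤ K) (i : ℕ) :
    rampLeft x K i ≤ rampRight x K i := by
  have hK0 := (lowerK_nonneg x).trans hK
  have hs := spacing_nonneg x i
  have : 0 ≤ spacing x i / (2 * K) := by positivity
  unfold rampLeft rampRight
  linarith

theorem rampRight_le_rampLeft {n : ℕ} (x : Fin n → ℝ) {K : ℝ} (hK : lowerK x ≤ K) {i j : ℕ}
    (h1 : 1 ≤ i) (hij : i < j) (h2 : j + 1 ≤ n) : rampRight x K i ≤ rampLeft x K j := by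
  have hn : (0 : ℝ) < n := by exact_mod_cast (by omega : 0 < n)
  have hi := halfWidth_le x hK h1 (by omega)
  have hj := halfWidth_le x hK (by omega) h2
  have hij' : ((i : ℝ) + 1) / n ≤ j / n := by
    gcongr
    exact_mod_cast hij
  have e : ((i : ℝ) + 1) / n = i / n + 1 / (2 * n) + 1 / (2 * n) := by
    field_simp
    ring
  unfold rampLeft rampRight
  linarith

/-- A closed form of `gStar`. -/
def clampSum {n : ℕ} (x : Fin n → ℝ) (K u : ℝ) : ℝ :=
  orderStat x 1 + ∑ j ∈ Finset.range (n - 1),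
    max 0 (min (K * (u - rampLeft x K (j + 1))) (spacing x (j + 1)))

theorem clamp_of_right {n : ℕ} (x : Fin n → ℝ) {K u : ℝ} (hK : lowerK x ≤ K) {i : ℕ}
    (h1 : 1 ≤ i) (h2 : i + 1 ≤ n) (hu : rampRight x K i ≤ u) :
    max 0 (min (K * (u - rampLeft x K i)) (spacing x i)) = spacing x i := by
  have hK0 := (lowerK_nonneg x).trans hK
  have hw := mul_halfWidth x hK h1 h2
  have : K * (rampRight x K i - rampLeft x K i) = spacing x i := by
    unfold rampLeft rampRight
    linear_combination 2 * hw
  rw [min_eq_right, max_eq_right (spacing_nonneg x i)]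
  nlinarith

theorem clamp_of_left {n : ℕ} (x : Fin n → ℝ) {K u : ℝ} (hK : lowerK x ≤ K) {i : ℕ}
    (hu : u ≤ rampLeft x K i) :
    max 0 (min (K * (u - rampLeft x K i)) (spacing x i)) = 0 := by
  have hK0 := (lowerK_nonneg x).trans hK
  apply max_eq_left
  apply (min_le_left _ _).trans
  nlinarith

theorem clamp_of_mem {n : ℕ} (x : Fin n → ℝ) {K u : ℝ} (hK : lowerK x ≤ K) {i : ℕ}
    (h1 : 1 ≤ i) (h2 : i + 1 ≤ n) (hu : u ∈ Icc (rampLeft x K i) (rampRight x K i)) :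
    max 0 (min (K * (u - rampLeft x K i)) (spacing x i)) = K * (u - rampLeft x K i) := by
  have hK0 := (lowerK_nonneg x).trans hK
  have hw := mul_halfWidth x hK h1 h2
  have : K * (rampRight x K i - rampLeft x K i) = spacing x i := by
    unfold rampLeft rampRight
    linear_combination 2 * hw
  obtain ⟨ha, hb⟩ := hu
  rw [min_eq_left, max_eq_right]
  · exact mul_nonneg hK0 (by linarith)
  · nlinarith

theorem sum_spacing {n : ℕ} (x : Fin n → ℝ) (m : ℕ) :
    ∑ j ∈ Finset.range m, spacing x (j + 1) = orderStat x (m + 1) - orderStat x 1 := by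
  simpa [spacing] using Finset.sum_range_sub (fun j => orderStat x (j + 1)) m

theorem clampSum_flat {n : ℕ} (x : Fin n → ℝ) {K u : ℝ} (hK : lowerK x ≤ K) (m : ℕ)
    (hm : m ≤ n - 1) (h1 : ∀ i, 1 ≤ i → i ≤ m → rampRight x K i ≤ u)
    (h2 : ∀ i, m < i → i + 1 ≤ n → u ≤ rampLeft x K i) :
    clampSum x K u = orderStat x (m + 1) := by
  unfold clampSum
  obtain ⟨k, hk⟩ := Nat.exists_eq_add_of_le hm
  rw [hk, Finset.sum_range_add, Finset.sum_congr rfl (fun j hj => ?_), sum_spacing,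
    Finset.sum_eq_zero (fun j hj => ?_)]
  · ring
  · have := Finset.mem_range.1 hj
    exact clamp_of_left x hK (h2 _ (by omega) (by omega))
  · have := Finset.mem_range.1 hj
    exact clamp_of_right x hK (by omega) (by omega) (h1 _ (by omega) (by omega))

theorem clampSum_ramp {n : ℕ} (x : Fin n → ℝ) {K u : ℝ} (hK : lowerK x ≤ K) {i : ℕ}
    (h1 : 1 ≤ i) (h2 : i + 1 ≤ n) (hu : u ∈ Icc (rampLeft x K i) (rampRight x K i)) :
    clampSum x K u = orderStat x i + K * (u - rampLeft x K i) := by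
  unfold clampSum
  obtain ⟨m, rfl⟩ := Nat.exists_eq_add_of_le' h1
  obtain ⟨k, hk⟩ := Nat.exists_eq_add_of_le (show m + 1 ≤ n - 1 by omega)
  rw [hk, Finset.sum_range_add, Finset.sum_range_succ, Finset.sum_congr rfl (fun j hj => ?_),
    sum_spacing, Finset.sum_eq_zero (fun j hj => ?_), clamp_of_mem x hK h1 h2 hu]
  · ring
  · have := Finset.mem_range.1 hj
    exact clamp_of_left x hK
      (hu.2.trans (rampRight_le_rampLeft x hK h1 (by omega) (by omega)))
  · have := Finset.mem_range.1 hj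
    exact clamp_of_right x hK (by omega) (by omega)
      ((rampRight_le_rampLeft x hK (by omega) (by omega) h2).trans hu.1)

theorem clampSum_first {n : ℕ} (x : Fin n → ℝ) {K u : ℝ} (hK : lowerK x ≤ K)
    (hu : u ≤ rampLeft x K 1) : clampSum x K u = orderStat x 1 := by
  refine clampSum_flat x hK 0 (Nat.zero_le _) (fun i h h' => by omega) fun i hi hn => ?_
  rcases (show 1 = i ∨ 1 < i by omega) with rfl | h
  · exact hu
  · exact hu.trans ((rampLeft_le_rampRight x hK 1).trans (rampRight_le_rampLeft x hK le_rfl h hn))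

theorem clampSum_plateau {n : ℕ} (x : Fin n → ℝ) {K u : ℝ} (hK : lowerK x ≤ K) {i : ℕ}
    (h1 : 1 ≤ i) (h2 : i + 2 ≤ n) (hu : u ∈ Icc (rampRight x K i) (rampLeft x K (i + 1))) :
    clampSum x K u = orderStat x (i + 1) := by
  refine clampSum_flat x hK i (by omega) (fun j hj hi => ?_) fun j hj hn => ?_
  · rcases (show j = i ∨ j < i by omega) with rfl | h
    · exact hu.1
    · exact (rampRight_le_rampLeft x hK hj h (by omega)).trans
        ((rampLeft_le_rampRight x hK i).trans hu.1)
  · rcases (show j = i + 1 ∨ i + 1 < j by omega) with rfl | h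
    · exact hu.2
    · exact hu.2.trans ((rampLeft_le_rampRight x hK _).trans
        (rampRight_le_rampLeft x hK (by omega) h hn))

theorem clampSum_last {n : ℕ} (x : Fin n → ℝ) {K u : ℝ} (hK : lowerK x ≤ K) (hn : 1 ≤ n)
    (hu : ∀ i, 1 ≤ i → i + 1 ≤ n → rampRight x K i ≤ u) :
    clampSum x K u = orderStat x n := by
  rw [clampSum_flat x hK (n - 1) le_rfl (fun i h h' => hu i h (by omega)) (fun i h h' => by omega),
    Nat.sub_add_cancel hn]

theorem gStar_eq_clampSum {n : ℕ} (x : Fin n → ℝ) {K : ℝ} (hn : 1 ≤ n) (hK : lowerK x ≤ K)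
    (u : ℝ) : gStar x K u = clampSum x K u := by
  classical
  unfold gStar
  split_ifs with c1 c2 c3
  · exact (clampSum_first x hK c1).symm
  · have h := Nat.find_spec c2
    exact (clampSum_ramp x hK h.1.1 h.1.2 h.2).symm
  · have h := Nat.find_spec c3
    exact (clampSum_plateau x hK h.1.1 h.1.2 h.2).symm
  · refine (clampSum_last x hK hn fun i h1 => ?_).symm
    induction i, h1 using Nat.le_induction with
    | base =>
      intro h2
      by_contra! h
      exact c2 ⟨1, ⟨le_rfl, h2⟩, (not_le.1 c1).le, h.le⟩
    | succ i h1 ih =>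
      intro h2
      by_contra! h
      have hi := ih (by omega)
      rcases le_total u (rampLeft x K (i + 1)) with h' | h'
      · exact c3 ⟨i, ⟨h1, by omega⟩, hi, h'⟩
      · exact c2 ⟨i + 1, ⟨by omega, h2⟩, h', h.le⟩

theorem gStar_first {n : ℕ} (x : Fin n → ℝ) {K u : ℝ} (hu : u ≤ rampLeft x K 1) :
    gStar x K u = orderStat x 1 := by
  simp [gStar, hu]

theorem gStar_ramp {n : ℕ} (x : Fin n → ℝ) {K u : ℝ} (hK : lowerK x ≤ K) {i : ℕ}
    (h1 : 1 ≤ i) (h2 : i + 1 ≤ n) (hu : u ∈ Icc (rampLeft x K i) (rampRight x K i)) :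
    gStar x K u = orderStat x i + K * (u - rampLeft x K i) := by
  rw [gStar_eq_clampSum x (by omega) hK, clampSum_ramp x hK h1 h2 hu]

theorem gStar_plateau {n : ℕ} (x : Fin n → ℝ) {K u : ℝ} (hK : lowerK x ≤ K) {i : ℕ}
    (h1 : 1 ≤ i) (h2 : i + 2 ≤ n) (hu : u ∈ Icc (rampRight x K i) (rampLeft x K (i + 1))) :
    gStar x K u = orderStat x (i + 1) := by
  rw [gStar_eq_clampSum x (by omega) hK, clampSum_plateau x hK h1 h2 hu]

theorem gStar_last {n : ℕ} (x : Fin n → ℝ) {K u : ℝ} (hK : lowerK x ≤ K) (hn : 2 ≤ n)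
    (hu : rampRight x K (n - 1) ≤ u) : gStar x K u = orderStat x n := by
  rw [gStar_eq_clampSum x (by omega) hK, clampSum_last x hK (by omega) fun i h1 h2 => ?_]
  rcases (show i = n - 1 ∨ i < n - 1 by omega) with rfl | h
  · exact hu
  · exact (rampRight_le_rampLeft x hK h1 h (by omega)).trans
      ((rampLeft_le_rampRight x hK _).trans hu)

/-- The distribution of `G(U)`, for `U` uniform on `[0,1]`. -/
def pushUniform (G : ℝ → ℝ) : Measure ℝ :=
  (volume.restrict (Icc (0 : ℝ) 1)).map G

/-- The `1`-Wasserstein distance: infimum of `∫ |x - y| dπ(x,y)` over all couplings `π`. -/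
def W1 (π₁ π₂ : Measure ℝ) : ℝ≥0∞ :=
  ⨅ (π : Measure (ℝ × ℝ)) (_ : π.map Prod.fst = π₁ ∧ π.map Prod.snd = π₂),
    ∫⁻ z, ENNReal.ofReal |z.1 - z.2| ∂π

/-- `Z n = O(a n)` in probability, for nonnegative random quantities `Z n`. -/
def BigOInProb {Ω : Type*} [MeasurableSpace Ω] (P : Measure Ω)
    (Z : ℕ → Ω → ℝ≥0∞) (a : ℕ → ℝ) : Prop :=
  ∀ ε : ℝ≥0∞, 0 < ε → ∃ M : ℝ, ∀ᶠ n in atTop,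
    P {ω | ENNReal.ofReal (M * a n) < Z n ω} ≤ ε

/-- `μ` has a density on `[A,B]` which is strictly positive and continuously differentiable
on `[A,B]`, and attains its minimum over `[A,B]` at exactly one point. -/
def HasNiceDensity (μ : Measure ℝ) (A B : ℝ) : Prop :=
  ∃ f : ℝ → ℝ,
    μ = (volume.restrict (Icc A B)).withDensity (fun x => ENNReal.ofReal (f x)) ∧
    (∀ x ∈ Icc A B, 0 < f x) ∧
    ContDiffOn ℝ 1 f (Icc A B) ∧
    ∃! x, x ∈ Icc A B ∧ IsMinOn f (Icc A B) x

/-- The sample `X_1, …, X_n` consisting of the first `n` observations. -/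
def sample {Ω : Type*} (X : ℕ → Ω → ℝ) (n : ℕ) (ω : Ω) : Fin n → ℝ :=
  fun i => X i ω

end

end WGAN

namespace WGAN

/-! ### Order statistics -/

/-! Part 2. Write `Q` for the quantile function of `μ`, `F` for its distribution function and `Fₙ`
for the empirical one. Driving `gStar` and `Q` by the same uniform variable is a coupling, so the
distance is at most `∫ |gStar - Q|` over `[0,1]`, which by Tonelli is an integral over levels `y ∈
[A,B]`. At level `y`, the set where `Q ≤ y` is `[0, F y]`. Each ramp has half-width at most `1/(2n)`
as soon as `lowerK x ≤ K`, so the set where `gStar ≤ y` is `[0, Fₙ y]` up to an error `1/(2n)` at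
the end. Hence the distance is at most `∫ (|Fₙ - F| + 1/n)` (`W1_gStar_le`). This bound no longer
involves `K`; its mean is `O(n^(-1/2))` by a variance computation, and Markov's inequality
concludes.

Part 1. The density is bounded, so an interval of length `δ` has mass at most `M * δ`. Cut an
interior interval into about `2^k` cells of length `r / 2^k`. A cell is missed by `k * 2^k`
observations with probability at least `(3/4)^k`, and the events of missing different cells are
nonpositively correlated. By the second moment method all cells are hit with probability at most
`(2/3)^k`, and Borel–Cantelli gives an empty cell for all large `k`. Observations near `A` and near
`B` eventually lie on either side of it, so it is contained in a genuine spacing. Interpolating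
between consecutive `k` gives `lowerK ≥ c * log n`. -/

theorem orderStat_mem_range {n : ℕ} (x : Fin n → ℝ) (hn : 1 ≤ n) (i : ℕ) :
    ∃ j, orderStat x i = x j := by
  unfold orderStat
  rw [dif_neg (by omega)]
  exact ⟨_, rfl⟩

theorem exists_orderStat_eq {n : ℕ} (x : Fin n → ℝ) (j : Fin n) :
    ∃ i, 1 ≤ i ∧ i ≤ n ∧ orderStat x i = x j := by
  have hj := j.2
  refine ⟨((Tuple.sort x).symm j : ℕ) + 1, by omega, by omega, ?_⟩
  unfold orderStat
  rw [dif_neg (by omega)]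
  congr 1
  rw [← Equiv.eq_symm_apply]
  ext
  simp only [Nat.add_sub_cancel]
  omega

theorem orderStat_one_le {n : ℕ} (x : Fin n → ℝ) (j : Fin n) : orderStat x 1 ≤ x j := by
  obtain ⟨i, h1, -, h⟩ := exists_orderStat_eq x j
  exact h ▸ orderStat_mono x h1

theorem le_orderStat_last {n : ℕ} (x : Fin n → ℝ) (j : Fin n) : x j ≤ orderStat x n := by
  obtain ⟨i, -, h1, h⟩ := exists_orderStat_eq x j
  exact h ▸ orderStat_mono x h1

/-- A gap in the sample, with sample points on both sides, bounds `lowerK` from below. -/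
theorem mul_gap_le_lowerK {n : ℕ} (x : Fin n → ℝ) {s t : ℝ} (hl : ∃ i, x i ≤ s)
    (hr : ∃ i, t < x i) (hst : s ≤ t) (hgap : ∀ i, x i ∉ Ioc s t) :
    n * (t - s) ≤ lowerK x := by
  classical
  obtain ⟨il, hl⟩ := hl
  obtain ⟨ir, hr⟩ := hr
  have hn : 1 ≤ n := by have := il.2; omega
  have hex : ∃ i, s < orderStat x i := ⟨n, hst.trans_lt (hr.trans_le (le_orderStat_last x ir))⟩
  -- `m` is the first rank whose order statistic exceeds `s`; the gap lies inside the spacing of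
  -- index `m - 1`.
  obtain ⟨m, hm⟩ : ∃ m, Nat.find hex = m := ⟨_, rfl⟩
  have h1 : s < orderStat x m := hm ▸ Nat.find_spec hex
  have hmin : ∀ i < m, orderStat x i ≤ s := fun i hi => not_lt.1 (Nat.find_min hex (hm ▸ hi))
  have hm2 : 1 < m := by
    by_contra! h
    exact absurd ((h1.trans_le (orderStat_mono x h)).trans_le (orderStat_one_le x il))
      (not_lt.2 hl)
  have hmn : m ≤ n := hm ▸ Nat.find_min' hex
    (hst.trans_lt (hr.trans_le (le_orderStat_last x ir)))
  obtain ⟨j, hj⟩ := orderStat_mem_range x hn m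
  have h2 : t < orderStat x m := by
    by_contra! h
    exact hgap j (hj ▸ ⟨h1, h⟩)
  have h3 := hmin (m - 1) (by omega)
  refine le_trans ?_ (mul_spacing_le x (i := m - 1) (by omega) (by omega))
  gcongr
  unfold spacing
  rw [Nat.sub_add_cancel hm2.le]
  linarith

/-- The empirical distribution function of the sample. -/
noncomputable def ecdf {n : ℕ} (x : Fin n → ℝ) (y : ℝ) : ℝ :=
  (∑ i, (Iic y).indicator (fun _ => (1 : ℝ)) (x i)) / n

theorem exists_ecdf_eq {n : ℕ} (x : Fin n → ℝ) (hn : 1 ≤ n) (y : ℝ) :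
    ∃ m ≤ n, ecdf x y = m / n ∧ (∀ i, 1 ≤ i → i ≤ m → orderStat x i ≤ y) ∧
      ∀ i, m < i → i ≤ n → y < orderStat x i := by
  classical
  have key : ∀ i : Fin n, orderStat x (i + 1) = x (Tuple.sort x i) := by
    intro i
    have := i.2
    unfold orderStat
    rw [dif_neg (by omega)]
    congr 2
    ext
    simp only [Nat.add_sub_cancel]
    omega
  obtain ⟨S, hS⟩ : ∃ S : Finset (Fin n), S = Finset.univ.filter fun i : Fin n => orderStat x (i + 1) ≤ y :=
    ⟨_, rfl⟩
  have hcount : ecdf x y = (S.card : ℝ) / n := by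
    unfold ecdf
    congr 1
    rw [← Equiv.sum_comp (Tuple.sort x)]
    simp only [indicator, mem_Iic, ← key]
    rw [hS, Finset.sum_boole]
  have hdown : ∀ i ∈ S, ∀ j ≤ i, j ∈ S := by
    intro i hi j hj
    simp only [hS, Finset.mem_filter, Finset.mem_univ, true_and] at hi ⊢
    exact (orderStat_mono x (by simpa using hj)).trans hi
  -- A down-closed subset of `Fin n` is an initial segment, hence determined by its cardinality.
  have hlt : ∀ i : Fin n, i ∈ S ↔ (i : ℕ) < S.card := by
    intro i
    constructor
    · intro hi
      have : Finset.Iic i ⊆ S := fun j hj => hdown i hi j (by simpa using hj)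
      have := Finset.card_le_card this
      simp only [Fin.card_Iic] at this
      omega
    · intro hi
      by_contra h
      have : S ⊆ Finset.Iio i := fun j hj => by
        simp only [Finset.mem_Iio]
        by_contra! h'
        exact h (hdown j hj i h')
      have := Finset.card_le_card this
      simp only [Fin.card_Iio] at this
      omega
  refine ⟨S.card, by simpa using Finset.card_le_univ S, hcount, fun i h1 h2 => ?_,
    fun i h1 h2 => ?_⟩
  · have hle : S.card ≤ n := by simpa using Finset.card_le_univ S
    have := (hlt ⟨i - 1, by omega⟩).2 (by simp only; omega)
    simpa [hS, Nat.sub_add_cancel h1] using this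
  · have := (hlt ⟨i - 1, by omega⟩).not.2 (by simp only; omega)
    simpa [hS, Nat.sub_add_cancel (show 1 ≤ i by omega)] using this

/-! ### The generator and the empirical distribution function -/

theorem clamp_nonneg {n : ℕ} (x : Fin n → ℝ) (K u : ℝ) (j : ℕ) :
    0 ≤ max 0 (min (K * (u - rampLeft x K j)) (spacing x j)) := le_max_left _ _

theorem clamp_le_spacing {n : ℕ} (x : Fin n → ℝ) (K u : ℝ) (j : ℕ) :
    max 0 (min (K * (u - rampLeft x K j)) (spacing x j)) ≤ spacing x j :=
  max_le (spacing_nonneg x j) (min_le_right _ _)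

theorem clampSum_mem_Icc {n : ℕ} (x : Fin n → ℝ) (hn : 1 ≤ n) (K u : ℝ) :
    clampSum x K u ∈ Icc (orderStat x 1) (orderStat x n) := by
  unfold clampSum
  constructor
  · exact le_add_of_nonneg_right (Finset.sum_nonneg fun j _ => clamp_nonneg x K u _)
  · have := Finset.sum_le_sum fun j (_ : j ∈ Finset.range (n - 1)) =>
      clamp_le_spacing x K u (j + 1)
    rw [sum_spacing, Nat.sub_add_cancel hn] at this
    linarith

theorem continuous_clampSum {n : ℕ} (x : Fin n → ℝ) (K : ℝ) : Continuous (clampSum x K) := by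
  unfold clampSum
  fun_prop

/-- If `m` sample points are `≤ y`, the ramps of index at most `m` are finished by `m/n + 1/(2n)`;
past that point the generator is at least `X_(m+1) > y`. -/
theorem le_of_clampSum_le {n : ℕ} (x : Fin n → ℝ) (hn : 1 ≤ n) {K : ℝ} (hK : lowerK x ≤ K)
    {u y : ℝ} (hu : u ≤ 1) (h : clampSum x K u ≤ y) : u ≤ ecdf x y + 1 / (2 * n) := by
  obtain ⟨m, hmn, he, -, hgt⟩ := exists_ecdf_eq x hn y
  have hn0 : (0 : ℝ) < n := by exact_mod_cast hn
  rw [he]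
  by_contra! hlt
  -- There is no `X_(n+1)`; the case `m = n` is excluded by `u ≤ 1`.
  have hm : m < n := by
    by_contra! h'
    obtain rfl : m = n := le_antisymm hmn h'
    rw [div_self hn0.ne'] at hlt
    have : (0 : ℝ) < 1 / (2 * m) := by positivity
    linarith
  have h1 : orderStat x (m + 1) ≤ clampSum x K u := by
    unfold clampSum
    obtain ⟨k, hk⟩ := Nat.exists_eq_add_of_le (show m ≤ n - 1 by omega)
    rw [hk, Finset.sum_range_add, Finset.sum_congr rfl (fun j hj => ?_), sum_spacing]
    · have := Finset.sum_nonneg fun j (_ : j ∈ Finset.range k) => clamp_nonneg x K u (m + j + 1)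
      linarith
    · have := Finset.mem_range.1 hj
      refine clamp_of_right x hK (by omega) (by omega) (le_trans ?_ hlt.le)
      refine add_le_add ?_ (halfWidth_le x hK (by omega) (by omega))
      gcongr
      exact_mod_cast this
  exact absurd (hgt (m + 1) (by omega) (by omega)) (not_lt.2 (h1.trans h))

/-- The mirror image: the ramps of index at least `m` have not started before `m/n - 1/(2n)`, so the
generator is still at most `X_(m) ≤ y`. -/
theorem clampSum_le_of_lt {n : ℕ} (x : Fin n → ℝ) (hn : 1 ≤ n) {K : ℝ} (hK : lowerK x ≤ K)
    {u y : ℝ} (hu : 0 ≤ u) (h : u < ecdf x y - 1 / (2 * n)) : clampSum x K u ≤ y := by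
  obtain ⟨m, hmn, he, hle, -⟩ := exists_ecdf_eq x hn y
  have hn0 : (0 : ℝ) < n := by exact_mod_cast hn
  rw [he] at h
  have hm : 1 ≤ m := by
    by_contra! h'
    obtain rfl : m = 0 := by omega
    have : (0 : ℝ) < 1 / (2 * n) := by positivity
    simp only [Nat.cast_zero, zero_div] at h
    linarith
  refine le_trans ?_ (hle m hm le_rfl)
  unfold clampSum
  obtain ⟨k, hk⟩ := Nat.exists_eq_add_of_le (show m - 1 ≤ n - 1 by omega)
  rw [hk, Finset.sum_range_add, Finset.sum_eq_zero (s := Finset.range k) (fun j hj => ?_)]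
  · have := Finset.sum_le_sum fun j (_ : j ∈ Finset.range (m - 1)) =>
      clamp_le_spacing x K u (j + 1)
    rw [sum_spacing, Nat.sub_add_cancel hm] at this
    linarith
  · have := Finset.mem_range.1 hj
    refine clamp_of_left x hK (h.le.trans ?_)
    refine sub_le_sub ?_ (halfWidth_le x hK (by omega) (by omega))
    gcongr
    omega

/-! ### Transport on the line -/

theorem W1_pushUniform_le {G Q : ℝ → ℝ} (hG : Measurable G) (hQ : Measurable Q) :
    W1 (pushUniform G) (pushUniform Q) ≤
      ∫⁻ u in Icc (0 : ℝ) 1, ENNReal.ofReal |G u - Q u| := by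
  unfold W1 pushUniform
  refine iInf₂_le_of_le ((volume.restrict (Icc (0 : ℝ) 1)).map fun u => (G u, Q u)) ⟨?_, ?_⟩ ?_
  · rw [Measure.map_map measurable_fst (by fun_prop)]
    rfl
  · rw [Measure.map_map measurable_snd (by fun_prop)]
    rfl
  · rw [lintegral_map (by fun_prop) (by fun_prop)]

/-- The quantile function of a measure carried by a half-line `[A, ∞)`. -/
noncomputable def quantile (μ : Measure ℝ) (A u : ℝ) : ℝ :=
  sInf {x | A ≤ x ∧ min u 1 ≤ cdf μ x}

section quantile

variable {μ : Measure ℝ} [IsProbabilityMeasure μ] {A B : ℝ}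

theorem cdf_eq_one_of_compl (h : μ (Icc A B)ᶜ = 0) : cdf μ B = 1 := by
  rw [cdf_eq_real, measureReal_def, (prob_compl_eq_zero_iff measurableSet_Iic).1, ENNReal.toReal_one]
  refine measure_mono_null (fun x hx => ?_) h
  simp only [mem_compl_iff, mem_Iic, not_le, mem_Icc, not_and] at hx ⊢
  exact fun _ => hx

theorem cdf_eq_zero_of_compl (h : μ (Icc A B)ᶜ = 0) {x : ℝ} (hx : x < A) : cdf μ x = 0 := by
  rw [cdf_eq_real, measureReal_def, measure_mono_null (fun y hy => ?_) h, ENNReal.toReal_zero]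
  simp only [mem_compl_iff, mem_Iic, mem_Icc, not_and, not_le] at hy ⊢
  intro h'
  linarith

/-- Right continuity of the distribution function makes the infimum attained. The truncation `min u
1` keeps the set nonempty (it contains `B`) and `A ≤ x` keeps it bounded below, so the equivalence
holds for every real `u`. -/
theorem quantile_le_iff (hAB : A ≤ B) (h : μ (Icc A B)ᶜ = 0) {u x : ℝ} :
    quantile μ A u ≤ x ↔ A ≤ x ∧ min u 1 ≤ cdf μ x := by
  have hne : {x | A ≤ x ∧ min u 1 ≤ cdf μ x}.Nonempty :=
    ⟨B, hAB, by rw [cdf_eq_one_of_compl h]; exact min_le_right _ _⟩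
  have hbdd : BddBelow {x | A ≤ x ∧ min u 1 ≤ cdf μ x} := ⟨A, fun x hx => hx.1⟩
  refine ⟨fun hx => ?_, fun hx => csInf_le hbdd hx⟩
  refine ⟨(le_csInf hne fun x hx => hx.1).trans hx, ?_⟩
  refine le_trans ?_ (monotone_cdf μ hx)
  have hcont := (cdf μ).right_continuous (quantile μ A u)
  have htend : Tendsto (cdf μ) (𝓝[>] (quantile μ A u)) (𝓝 (cdf μ (quantile μ A u))) :=
    hcont.tendsto.mono_left (nhdsWithin_mono _ Ioi_subset_Ici_self)
  refine ge_of_tendsto htend ?_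
  filter_upwards [self_mem_nhdsWithin] with y hy
  obtain ⟨z, hz, hzy⟩ := exists_lt_of_csInf_lt hne hy
  exact hz.2.trans (monotone_cdf μ hzy.le)

theorem measurable_quantile (hAB : A ≤ B) (h : μ (Icc A B)ᶜ = 0) :
    Measurable (quantile μ A) := by
  refine measurable_of_Iic fun x => ?_
  have : quantile μ A ⁻¹' Iic x = {u | A ≤ x ∧ min u 1 ≤ cdf μ x} := by
    ext u
    exact quantile_le_iff hAB h
  rw [this]
  exact (MeasurableSet.const (A ≤ x)).inter
    (measurableSet_le (f := fun u : ℝ => min u 1) (by fun_prop) measurable_const)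

theorem quantile_mem_Icc (hAB : A ≤ B) (h : μ (Icc A B)ᶜ = 0) (u : ℝ) :
    quantile μ A u ∈ Icc A B :=
  ⟨((quantile_le_iff hAB h).1 le_rfl).1, (quantile_le_iff hAB h).2
    ⟨hAB, by rw [cdf_eq_one_of_compl h]; exact min_le_right _ _⟩⟩

/-- Inverse transform sampling: within `[0,1]`, the quantile is `≤ x` exactly on `[0, cdf μ x]` when
`A ≤ x`, and nowhere otherwise. -/
theorem pushUniform_quantile (hAB : A ≤ B) (h : μ (Icc A B)ᶜ = 0) :
    pushUniform (quantile μ A) = μ := by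
  have hm := measurable_quantile hAB h
  have : IsProbabilityMeasure (volume.restrict (Icc (0 : ℝ) 1)) := ⟨by simp⟩
  have : IsProbabilityMeasure (pushUniform (quantile μ A)) :=
    Measure.isProbabilityMeasure_map hm.aemeasurable
  refine Measure.ext_of_Iic _ _ fun x => ?_
  rw [pushUniform, Measure.map_apply hm measurableSet_Iic,
    Measure.restrict_apply (hm measurableSet_Iic), ← ofReal_cdf μ x]
  by_cases hx : A ≤ x
  · have : quantile μ A ⁻¹' Iic x ∩ Icc 0 1 = Icc 0 (cdf μ x) := by
      ext u
      have h1 := cdf_le_one μ x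
      simp only [mem_inter_iff, mem_preimage, mem_Iic, quantile_le_iff hAB h, hx, true_and, mem_Icc]
      constructor
      · rintro ⟨h2, h3, h4⟩
        rw [min_eq_left h4] at h2
        exact ⟨h3, h2⟩
      · rintro ⟨h2, h3⟩
        exact ⟨(min_le_left _ _).trans h3, h2, h3.trans h1⟩
    rw [this, Real.volume_Icc, sub_zero]
  · have : quantile μ A ⁻¹' Iic x ∩ Icc 0 1 = ∅ := by
      ext u
      simp [quantile_le_iff hAB h, hx]
    rw [this, cdf_eq_zero_of_compl h (not_le.1 hx)]
    simp

end quantile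

/-- Layer-cake formula for `∫ |G - Q|`. -/
theorem lintegral_abs_sub_eq {G Q : ℝ → ℝ} {A B : ℝ} (hG : Measurable G) (hQ : Measurable Q)
    (hGm : ∀ u, G u ∈ Icc A B) (hQm : ∀ u, Q u ∈ Icc A B) :
    ∫⁻ u in Icc (0 : ℝ) 1, ENNReal.ofReal |G u - Q u| =
      ∫⁻ x in Icc A B,
        volume ({u | min (G u) (Q u) ≤ x ∧ x < max (G u) (Q u)} ∩ Icc (0 : ℝ) 1) := by
  have hmeas : MeasurableSet {p : ℝ × ℝ | min (G p.1) (Q p.1) ≤ p.2 ∧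
      p.2 < max (G p.1) (Q p.1)} :=
    MeasurableSet.inter
      (measurableSet_le (f := fun p : ℝ × ℝ => min (G p.1) (Q p.1)) (by fun_prop) measurable_snd)
      (measurableSet_lt (g := fun p : ℝ × ℝ => max (G p.1) (Q p.1)) measurable_snd (by fun_prop))
  -- The integrand is the length of the interval between the two values, which lies in `[A,B]`;
  -- Tonelli then exchanges `u` and the level `x`.
  have h1 : ∀ u, ENNReal.ofReal |G u - Q u| = ∫⁻ x in Icc A B,
      {p : ℝ × ℝ | min (G p.1) (Q p.1) ≤ p.2 ∧ p.2 < max (G p.1) (Q p.1)}.indicator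
        (fun _ => (1 : ℝ≥0∞)) (u, x) := by
    intro u
    have : ∀ x, {p : ℝ × ℝ | min (G p.1) (Q p.1) ≤ p.2 ∧ p.2 < max (G p.1) (Q p.1)}.indicator
        (fun _ => (1 : ℝ≥0∞)) (u, x) =
        (Ico (min (G u) (Q u)) (max (G u) (Q u))).indicator (fun _ => 1) x := fun x => rfl
    simp only [this]
    rw [lintegral_indicator measurableSet_Ico, lintegral_const, one_mul,
      Measure.restrict_apply MeasurableSet.univ, univ_inter,
      Measure.restrict_apply measurableSet_Ico, inter_eq_left.2, Real.volume_Ico, max_sub_min_eq_abs,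
      abs_sub_comm]
    exact Ico_subset_Icc_self.trans (Icc_subset_Icc (le_min (hGm u).1 (hQm u).1)
      (max_le (hGm u).2 (hQm u).2))
  simp only [h1]
  rw [lintegral_lintegral_swap]
  · refine lintegral_congr fun x => ?_
    have : ∀ u, {p : ℝ × ℝ | min (G p.1) (Q p.1) ≤ p.2 ∧ p.2 < max (G p.1) (Q p.1)}.indicator
        (fun _ => (1 : ℝ≥0∞)) (u, x) =
        {u | min (G u) (Q u) ≤ x ∧ x < max (G u) (Q u)}.indicator (fun _ => 1) u := fun x => rfl
    have hm : MeasurableSet {u | min (G u) (Q u) ≤ x ∧ x < max (G u) (Q u)} :=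
      hmeas.preimage (measurable_id.prodMk measurable_const)
    simp only [this]
    rw [lintegral_indicator hm, lintegral_const, one_mul,
      Measure.restrict_apply MeasurableSet.univ, univ_inter, Measure.restrict_apply hm]
  · exact (measurable_const.indicator hmeas).aemeasurable

theorem W1_gStar_le {n : ℕ} (x : Fin n → ℝ) (hn : 1 ≤ n) {K : ℝ} (hK : lowerK x ≤ K)
    {μ : Measure ℝ} [IsProbabilityMeasure μ] {A B : ℝ} (hAB : A ≤ B) (h : μ (Icc A B)ᶜ = 0)
    (hx : ∀ i, x i ∈ Icc A B) :
    W1 (pushUniform (gStar x K)) μ ≤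
      ∫⁻ y in Icc A B, ENNReal.ofReal (|ecdf x y - cdf μ y| + 1 / n) := by
  have hn0 : (0 : ℝ) < n := by exact_mod_cast hn
  have hQ := measurable_quantile hAB h
  have hG : gStar x K = clampSum x K := funext fun u => gStar_eq_clampSum x hn hK u
  have hGm : ∀ u, clampSum x K u ∈ Icc A B := by
    intro u
    obtain ⟨i, hi⟩ := orderStat_mem_range x hn 1
    obtain ⟨j, hj⟩ := orderStat_mem_range x hn n
    have := clampSum_mem_Icc x hn K u
    rw [hi, hj] at this
    exact ⟨(hx i).1.trans this.1, this.2.trans (hx j).2⟩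
  rw [hG]
  conv_lhs => rw [← pushUniform_quantile hAB h]
  refine (W1_pushUniform_le (continuous_clampSum x K).measurable hQ).trans ?_
  rw [lintegral_abs_sub_eq (continuous_clampSum x K).measurable hQ hGm (quantile_mem_Icc hAB h)]
  refine setLIntegral_mono_ae' measurableSet_Icc (ae_of_all _ fun y hy => ?_)
  -- A `u` at which exactly one of the two functions is `≤ y` lies between `ecdf x y` and `cdf μ y`,
  -- up to `1/(2n)` on either side.
  have hsub : {u | min (clampSum x K u) (quantile μ A u) ≤ y ∧
      y < max (clampSum x K u) (quantile μ A u)} ∩ Icc (0 : ℝ) 1 ⊆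
      Icc (min (ecdf x y) (cdf μ y) - 1 / (2 * n)) (max (ecdf x y) (cdf μ y) + 1 / (2 * n)) := by
    rintro u ⟨⟨h1, h2⟩, hu0, hu1⟩
    have hpos : 0 < 1 / (2 * (n : ℝ)) := by positivity
    have hq : quantile μ A u ≤ y ↔ u ≤ cdf μ y := by
      rw [quantile_le_iff hAB h, min_eq_left hu1]
      simp [hy.1]
    have ha := le_of_clampSum_le x hn hK (y := y) hu1
    have hb := (clampSum_le_of_lt x hn hK (y := y) hu0).mt
    have e1 := min_le_left (ecdf x y) (cdf μ y)
    have e2 := min_le_right (ecdf x y) (cdf μ y)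
    have e3 := le_max_left (ecdf x y) (cdf μ y)
    have e4 := le_max_right (ecdf x y) (cdf μ y)
    rcases le_or_gt (quantile μ A u) y with hc | hc
    · have hg : y < clampSum x K u := by
        rcases lt_max_iff.1 h2 with h | h
        · exact h
        · exact absurd h (not_lt.2 hc)
      have := hq.1 hc
      have := not_lt.1 (hb (not_le.2 hg))
      constructor <;> linarith
    · have hg : clampSum x K u ≤ y := by
        rcases min_le_iff.1 h1 with h | h
        · exact h
        · exact absurd hc (not_lt.2 h)
      have := ha hg
      have := not_le.1 (hq.not.1 (not_le.2 hc))
      constructor <;> linarith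
  refine (measure_mono hsub).trans ?_
  rw [Real.volume_Icc]
  apply ENNReal.ofReal_le_ofReal
  have := max_sub_min_eq_abs (ecdf x y) (cdf μ y)
  rw [abs_sub_comm] at this
  have e : 1 / (n : ℝ) = 1 / (2 * n) + 1 / (2 * n) := by field_simp; norm_num
  linarith

/-! ### The empirical distribution function of an i.i.d. sample -/

section iid

variable {Ω : Type*} [MeasurableSpace Ω] {P : Measure Ω} [IsProbabilityMeasure P]
  {μ : Measure ℝ} [IsProbabilityMeasure μ] {X : ℕ → Ω → ℝ}

theorem lintegral_abs_ecdf_sub_cdf_le (hX : ∀ i, Measurable (X i))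
    (hlaw : ∀ i, P.map (X i) = μ) (hindep : iIndepFun X P) {n : ℕ} (hn : 1 ≤ n) (y : ℝ) :
    ∫⁻ ω, ENNReal.ofReal |ecdf (sample X n ω) y - cdf μ y| ∂P ≤
      ENNReal.ofReal (1 / √n) := by
  have hn0 : (0 : ℝ) < n := by exact_mod_cast hn
  have hind : Measurable ((Iic y).indicator fun _ => (1 : ℝ)) :=
    measurable_const.indicator measurableSet_Iic
  let Y : Fin n → Ω → ℝ := fun i ω => (Iic y).indicator (fun _ => (1 : ℝ)) (X i ω)
  have hYm : ∀ i, Measurable (Y i) := fun i => hind.comp (hX i)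
  have hYb : ∀ i ω, Y i ω ∈ Icc (0 : ℝ) 1 := fun i ω => by
    simp only [Y, indicator]
    split_ifs <;> simp
  have hY2 : ∀ i, MemLp (Y i) 2 P := fun i =>
    MemLp.of_bound (hYm i).aestronglyMeasurable 1 (ae_of_all _ fun ω => by
      rw [Real.norm_eq_abs, abs_of_nonneg (hYb i ω).1]
      exact (hYb i ω).2)
  have hYi : ∀ i, ∫ ω, Y i ω ∂P = cdf μ y := fun i => by
    rw [cdf_eq_real, ← hlaw i, map_measureReal_apply (hX i) measurableSet_Iic]
    exact integral_indicator_one ((hX i) measurableSet_Iic)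
  have hYindep : Pairwise fun i j => IndepFun (Y i) (Y j) P := by
    intro i j hij
    exact (hindep.indepFun (by simpa [Fin.val_inj] using hij)).comp hind hind
  have hvar1 : ∀ i, Var[Y i; P] ≤ 1 := fun i => by
    refine (variance_le_expectation_sq (hYm i).aestronglyMeasurable).trans ?_
    refine (integral_mono_of_nonneg (ae_of_all _ fun ω => sq_nonneg (Y i ω))
      (integrable_const (1 : ℝ)) (ae_of_all _ fun ω => ?_)).trans (by simp)
    exact pow_le_one₀ (hYb i ω).1 (hYb i ω).2
  have hvar : Var[∑ i, Y i; P] ≤ n := by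
    rw [IndepFun.variance_sum (fun i _ => hY2 i) (fun i _ j _ hij => hYindep hij)]
    exact (Finset.sum_le_sum fun i _ => hvar1 i).trans (by simp)
  have hS2 : MemLp (∑ i, Y i) 2 P := memLp_finsetSum' _ fun i _ => hY2 i
  have hmean : ∫ ω, (∑ i, Y i) ω ∂P = n * cdf μ y := by
    simp only [Finset.sum_apply]
    rw [integral_finsetSum _ fun i _ => (hY2 i).integrable one_le_two]
    simp [hYi]
  rw [variance_eq_integral hS2.aemeasurable, hmean] at hvar
  have hsq : Integrable (fun ω => ((∑ i, Y i) ω - n * cdf μ y) ^ 2) P :=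
    (hS2.sub (memLp_const _)).integrable_sq
  have hs : 0 < √(n : ℝ) := Real.sqrt_pos.2 hn0
  have hss : √(n : ℝ) * √n = n := Real.mul_self_sqrt hn0.le
  -- AM-GM in place of Cauchy–Schwarz: the weights are chosen so that, with variance at most `n`,
  -- both terms integrate to at most `1/√n`.
  have hpt : ∀ ω, |ecdf (sample X n ω) y - cdf μ y| ≤
      (((∑ i, Y i) ω - n * cdf μ y) ^ 2 / (n * √n) + 1 / √n) / 2 := by
    intro ω
    have he : ecdf (sample X n ω) y - cdf μ y = ((∑ i, Y i) ω - n * cdf μ y) / n := by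
      simp only [ecdf, sample, Finset.sum_apply, Y]
      field_simp
    rw [he, abs_div, abs_of_pos hn0]
    generalize (∑ i, Y i) ω - n * cdf μ y = t
    rw [← sq_abs t]
    generalize |t| = a
    have key : ∀ s : ℝ, 0 < s → (a ^ 2 / (s * s * s) + 1 / s) / 2 - a / (s * s) =
        (a - s) ^ 2 / (2 * (s * s * s)) := by
      intro s hs
      field_simp
      ring
    have := key _ hs
    rw [hss] at this
    have : 0 ≤ (a - √n) ^ 2 / (2 * (n * √(n : ℝ))) := by positivity
    linarith
  refine (lintegral_mono fun ω => ENNReal.ofReal_le_ofReal (hpt ω)).trans ?_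
  have hint : Integrable
      (fun ω => (((∑ i, Y i) ω - n * cdf μ y) ^ 2 / (n * √n) + 1 / √n) / 2) P :=
    ((hsq.div_const _).add (integrable_const _)).div_const _
  rw [← ofReal_integral_eq_lintegral_ofReal hint (ae_of_all _ fun ω => by positivity)]
  apply ENNReal.ofReal_le_ofReal
  rw [integral_div, integral_add (hsq.div_const _) (integrable_const _), integral_div]
  simp only [integral_const, probReal_univ, one_smul]
  have : (∫ ω, ((∑ i, Y i) ω - n * cdf μ y) ^ 2 ∂P) / (n * √n) ≤ 1 / √n := by
    rw [div_le_div_iff₀ (by positivity) hs]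
    nlinarith
  linarith

theorem measurable_ecdf_sample (hX : ∀ i, Measurable (X i)) (n : ℕ) :
    Measurable fun p : Ω × ℝ => ecdf (sample X n p.1) p.2 := by
  unfold ecdf sample
  refine Measurable.div_const (Finset.measurable_sum _ fun i _ => ?_) _
  have hs : MeasurableSet {p : Ω × ℝ | X i p.1 ≤ p.2} :=
    measurableSet_le ((hX i).comp measurable_fst) measurable_snd
  exact (measurable_const (a := (1 : ℝ))).indicator hs

theorem bigOInProb_W1_gStar (hX : ∀ i, Measurable (X i))
    (hlaw : ∀ i, P.map (X i) = μ) (hindep : iIndepFun X P) {A B : ℝ} (hAB : A < B)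
    (hsupp : μ (Icc A B)ᶜ = 0) (K : ℕ → Ω → ℝ)
    (hK : ∀ n, 1 ≤ n → ∀ᵐ ω ∂P, lowerK (sample X n ω) ≤ K n ω) :
    BigOInProb P (fun n ω => W1 (pushUniform (gStar (sample X n ω) (K n ω))) μ)
      (fun n => (n : ℝ) ^ (-(1 / 2) : ℝ)) := by
  have hmem : ∀ᵐ ω ∂P, ∀ i, X i ω ∈ Icc A B := by
    rw [ae_all_iff]
    intro i
    have : ∀ᵐ x ∂(P.map (X i)), x ∈ Icc A B := by
      rw [hlaw i]
      exact hsupp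
    exact ae_of_ae_map (hX i).aemeasurable this
  have hF : Measurable (cdf μ) := (monotone_cdf μ).measurable
  have hmeas : ∀ n, Measurable fun p : Ω × ℝ =>
      ENNReal.ofReal (|ecdf (sample X n p.1) p.2 - cdf μ p.2| + 1 / n) := fun n =>
    ((((measurable_ecdf_sample hX n).sub (hF.comp measurable_snd)).abs).add_const _).ennreal_ofReal
  have hmean : ∀ n : ℕ, 1 ≤ n →
      ∫⁻ ω, (∫⁻ y in Icc A B,
        ENNReal.ofReal (|ecdf (sample X n ω) y - cdf μ y| + 1 / n)) ∂P ≤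
      ENNReal.ofReal (2 * (B - A) / √n) := by
    intro n hn
    have hn1 : (1 : ℝ) ≤ n := by exact_mod_cast hn
    rw [lintegral_lintegral_swap (hmeas n).aemeasurable]
    have : ∀ y, ∫⁻ ω, ENNReal.ofReal (|ecdf (sample X n ω) y - cdf μ y| + 1 / n) ∂P ≤
        ENNReal.ofReal (2 / √n) := by
      intro y
      simp_rw [fun ω => ENNReal.ofReal_add (abs_nonneg (ecdf (sample X n ω) y - cdf μ y))
        (show (0 : ℝ) ≤ 1 / n by positivity)]
      rw [lintegral_add_right _ measurable_const, lintegral_const, measure_univ, mul_one]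
      refine (add_le_add_left (lintegral_abs_ecdf_sub_cdf_le hX hlaw hindep hn y) _).trans ?_
      rw [← ENNReal.ofReal_add (by positivity) (by positivity)]
      apply ENNReal.ofReal_le_ofReal
      have : 1 / (n : ℝ) ≤ 1 / √n := by
        apply one_div_le_one_div_of_le (Real.sqrt_pos.2 (by linarith))
        exact Real.sqrt_le_iff.2 ⟨by linarith, by nlinarith⟩
      calc _ ≤ 1 / √(n : ℝ) + 1 / √n := by gcongr
        _ = _ := by ring
    refine (lintegral_mono this).trans ?_
    rw [lintegral_const, Measure.restrict_apply MeasurableSet.univ, univ_inter, Real.volume_Icc,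
      ← ENNReal.ofReal_mul (by positivity)]
    exact ENNReal.ofReal_le_ofReal (le_of_eq (by ring))
  intro ε hε
  -- `ε` may be `∞`, so a real `δ` below it is used.
  obtain ⟨δ, hδ0, hδ⟩ : ∃ δ : ℝ, 0 < δ ∧ ENNReal.ofReal δ ≤ ε := by
    obtain ⟨δ, -, h0, h1⟩ := ENNReal.lt_iff_exists_real_btwn.1 hε
    exact ⟨δ, ENNReal.ofReal_pos.1 h0, h1.le⟩
  have hM : 0 < 2 * (B - A) / δ := by
    have := sub_pos.2 hAB
    positivity
  refine ⟨2 * (B - A) / δ, ?_⟩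
  filter_upwards [eventually_ge_atTop 1] with n hn
  have hn0 : (0 : ℝ) < n := by exact_mod_cast hn
  have hs : 0 < √(n : ℝ) := Real.sqrt_pos.2 hn0
  have hrate : (n : ℝ) ^ (-(1 / 2) : ℝ) = 1 / √n := by
    rw [Real.rpow_neg hn0.le, ← Real.sqrt_eq_rpow, one_div]
  have hDm : Measurable fun ω => ∫⁻ y in Icc A B,
      ENNReal.ofReal (|ecdf (sample X n ω) y - cdf μ y| + 1 / n) :=
    (hmeas n).lintegral_prod_right'
  have hc : 0 < 2 * (B - A) / δ * (1 / √n) := by positivity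
  calc P {ω | ENNReal.ofReal (2 * (B - A) / δ * (n : ℝ) ^ (-(1 / 2) : ℝ)) <
        W1 (pushUniform (gStar (sample X n ω) (K n ω))) μ}
      ≤ P {ω | ENNReal.ofReal (2 * (B - A) / δ * (1 / √n)) ≤ ∫⁻ y in Icc A B,
          ENNReal.ofReal (|ecdf (sample X n ω) y - cdf μ y| + 1 / n)} := by
        rw [hrate]
        -- The event on the left need not be measurable, as `K` is arbitrary; it is contained a.e.
        -- in a measurable event free of `K`.
        refine measure_mono_ae ?_
        filter_upwards [hmem, hK n hn] with ω hω hKω hlt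
        exact (le_of_lt hlt).trans (W1_gStar_le _ hn hKω hAB.le hsupp fun i => hω i)
    _ ≤ (∫⁻ ω, (∫⁻ y in Icc A B,
          ENNReal.ofReal (|ecdf (sample X n ω) y - cdf μ y| + 1 / n)) ∂P) /
          ENNReal.ofReal (2 * (B - A) / δ * (1 / √n)) :=
        meas_ge_le_lintegral_div hDm.aemeasurable (ENNReal.ofReal_pos.2 hc).ne'
          ENNReal.ofReal_ne_top
    _ ≤ ENNReal.ofReal (2 * (B - A) / √n) / ENNReal.ofReal (2 * (B - A) / δ * (1 / √n)) := by
        gcongr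
        exact hmean n hn
    _ = ENNReal.ofReal δ := by
        rw [← ENNReal.ofReal_div_of_pos hc]
        have := (sub_pos.2 hAB).ne'
        congr 1
        field_simp
    _ ≤ ε := hδ

end iid

/-! ### The largest spacing -/

section gaps

variable {Ω : Type*} [MeasurableSpace Ω] {P : Measure Ω} [IsProbabilityMeasure P]
  {μ : Measure ℝ} [IsProbabilityMeasure μ] {X : ℕ → Ω → ℝ}

/-- Second moment method: for pairwise nonpositively correlated events, the probability that none
occurs is at most the inverse of the expected number of occurrences. -/
theorem measureReal_iInter_compl_mul_sum_le {ι : Type*} (s : Finset ι) {E : ι → Set Ω}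
    (hE : ∀ i, MeasurableSet (E i))
    (hcorr : ∀ i ∈ s, ∀ j ∈ s, i ≠ j → P.real (E i ∩ E j) ≤ P.real (E i) * P.real (E j)) :
    P.real (⋂ i ∈ s, (E i)ᶜ) * ∑ i ∈ s, P.real (E i) ≤ 1 := by
  classical
  obtain ⟨a, ha⟩ : ∃ a, a = ∑ i ∈ s, P.real (E i) := ⟨_, rfl⟩
  have ha0 : 0 ≤ a := ha ▸ Finset.sum_nonneg fun i _ => measureReal_nonneg
  rw [← ha]
  rcases ha0.eq_or_lt with h0 | hpos
  · rw [← h0, mul_zero]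
    exact zero_le_one
  let N : Ω → ℝ := fun ω => ∑ i ∈ s, (E i).indicator 1 ω
  have hI : ∀ F : Set Ω, MeasurableSet F → Integrable (F.indicator (1 : Ω → ℝ)) P := fun F hF =>
    (integrable_const (1 : ℝ)).indicator hF
  have hNi : Integrable N P := integrable_finsetSum _ fun i _ => hI _ (hE i)
  have hN : ∫ ω, N ω ∂P = a := by
    rw [integral_finsetSum _ fun i _ => hI _ (hE i), ha]
    exact Finset.sum_congr rfl fun i _ => integral_indicator_one (hE i)
  have hsq : ∀ ω, N ω ^ 2 = ∑ i ∈ s, ∑ j ∈ s, (E i ∩ E j).indicator 1 ω := by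
    intro ω
    rw [sq, Finset.sum_mul_sum]
    simp only [inter_indicator_one, Pi.mul_apply]
  have hNsqi : Integrable (fun ω => N ω ^ 2) P := by
    simp only [hsq]
    exact integrable_finsetSum _ fun i _ => integrable_finsetSum _ fun j _ =>
      hI _ ((hE i).inter (hE j))
  -- Off-diagonal pairs contribute at most `a ^ 2` by the correlation hypothesis, the diagonal
  -- contributes `a`.
  have hNsq : ∫ ω, N ω ^ 2 ∂P ≤ a ^ 2 + a := by
    simp only [hsq]
    rw [integral_finsetSum _ fun i _ => integrable_finsetSum _ fun j _ =>
      hI _ ((hE i).inter (hE j))]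
    have : ∀ i ∈ s, ∫ ω, ∑ j ∈ s, (E i ∩ E j).indicator (1 : Ω → ℝ) ω ∂P ≤
        P.real (E i) * a + P.real (E i) := by
      intro i hi
      rw [integral_finsetSum _ fun j _ => hI _ ((hE i).inter (hE j))]
      have h1 : ∀ j ∈ s, ∫ ω, (E i ∩ E j).indicator (1 : Ω → ℝ) ω ∂P ≤
          P.real (E i) * P.real (E j) + if i = j then P.real (E i) else 0 := by
        intro j hj
        rw [integral_indicator_one ((hE i).inter (hE j))]
        split_ifs with h
        · rw [← h, inter_self]
          exact le_add_of_nonneg_left (by positivity)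
        · rw [add_zero]
          exact hcorr i hi j hj h
      refine (Finset.sum_le_sum h1).trans ?_
      rw [Finset.sum_add_distrib, ← Finset.mul_sum, ← ha, Finset.sum_ite_eq, if_pos hi]
    refine (Finset.sum_le_sum this).trans ?_
    rw [Finset.sum_add_distrib, ← Finset.sum_mul, ← ha, sq]
  have hF : MeasurableSet (⋂ i ∈ s, (E i)ᶜ) :=
    Finset.measurableSet_biInter _ fun i _ => (hE i).compl
  -- Chebyshev: `(N - a) ^ 2` equals `a ^ 2` where no event occurs, and is nonnegative elsewhere.
  have hle : ∫ ω, a ^ 2 * (⋂ i ∈ s, (E i)ᶜ).indicator (1 : Ω → ℝ) ω ∂P ≤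
      ∫ ω, (N ω ^ 2 - 2 * a * N ω + a ^ 2) ∂P := by
    refine integral_mono ((hI _ hF).const_mul _)
      ((hNsqi.sub (hNi.const_mul _)).add (integrable_const _)) fun ω => ?_
    by_cases hω : ω ∈ ⋂ i ∈ s, (E i)ᶜ
    · have : N ω = 0 := Finset.sum_eq_zero fun i hi =>
        indicator_of_notMem (by simpa using mem_iInter₂.1 hω i hi) _
      simp [hω, this]
    · simp only [hω, not_false_eq_true, indicator_of_notMem, mul_zero]
      nlinarith [sq_nonneg (N ω - a)]
  have hexp : ∫ ω, (N ω ^ 2 - 2 * a * N ω + a ^ 2) ∂P =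
      ∫ ω, N ω ^ 2 ∂P - 2 * a * a + a ^ 2 := by
    have h := integral_add (hNsqi.sub (hNi.const_mul (2 * a))) (integrable_const (a ^ 2))
    simp only [Pi.sub_apply] at h
    rw [h, integral_sub hNsqi (hNi.const_mul _), integral_const_mul, hN]
    simp
  rw [integral_const_mul, integral_indicator_one hF, hexp] at hle
  have : a * (P.real (⋂ i ∈ s, (E i)ᶜ) * a) ≤ a * 1 := by nlinarith
  exact le_of_mul_le_mul_left this hpos

theorem measurableSet_forall_notMem (hX : ∀ i, Measurable (X i)) {S : Set ℝ}
    (hS : MeasurableSet S) (n : ℕ) : MeasurableSet {ω | ∀ i < n, X i ω ∉ S} := by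
  simp only [ofPred_forall]
  exact MeasurableSet.iInter fun i => MeasurableSet.iInter fun _ => (hX i hS).compl

omit [IsProbabilityMeasure P] in
theorem measureReal_forall_notMem (hX : ∀ i, Measurable (X i)) (hlaw : ∀ i, P.map (X i) = μ)
    (hindep : iIndepFun X P) {S : Set ℝ} (hS : MeasurableSet S) (n : ℕ) :
    P.real {ω | ∀ i < n, X i ω ∉ S} = (1 - μ.real S) ^ n := by
  have h := hindep.measure_inter_preimage_eq_mul (Finset.range n) (sets := fun _ => Sᶜ)
    fun _ _ => hS.compl
  have he : {ω | ∀ i < n, X i ω ∉ S} = ⋂ i ∈ Finset.range n, X i ⁻¹' Sᶜ := by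
    ext ω
    simp
  have hp : ∀ i, P (X i ⁻¹' Sᶜ) = μ Sᶜ := fun i => by
    rw [← hlaw i, Measure.map_apply (hX i) hS.compl]
  rw [he, measureReal_def, h]
  simp only [hp, Finset.prod_const, Finset.card_range, ENNReal.toReal_pow]
  rw [← measureReal_def, probReal_compl_eq_one_sub hS]

theorem ae_exists_mem (hX : ∀ i, Measurable (X i)) (hlaw : ∀ i, P.map (X i) = μ)
    (hindep : iIndepFun X P) {S : Set ℝ} (hS : MeasurableSet S) (hpos : 0 < μ S) :
    ∀ᵐ ω ∂P, ∃ i, X i ω ∈ S := by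
  have hp : 0 < μ.real S := ENNReal.toReal_pos hpos.ne' (measure_ne_top _ _)
  have hlim : Tendsto (fun n : ℕ => (1 - μ.real S) ^ n) atTop (𝓝 0) :=
    tendsto_pow_atTop_nhds_zero_of_lt_one (sub_nonneg.2 measureReal_le_one) (by linarith)
  have hle : P.real {ω | ¬ ∃ i, X i ω ∈ S} ≤ 0 := by
    refine ge_of_tendsto' hlim fun n => ?_
    rw [← measureReal_forall_notMem hX hlaw hindep hS n]
    refine measureReal_mono fun ω hω i _ hi => hω ⟨i, hi⟩
  exact (measureReal_eq_zero_iff).1 (le_antisymm hle measureReal_nonneg)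

/-- With high probability one of `m` equal cells is missed by the first `n` observations. -/
theorem measureReal_cells_hit_mul_le (hX : ∀ i, Measurable (X i))
    (hlaw : ∀ i, P.map (X i) = μ) (hindep : iIndepFun X P) {M : ℝ}
    (hM : ∀ s t, s ≤ t → μ.real (Ioc s t) ≤ M * (t - s)) (a : ℝ) {δ : ℝ} (hδ : 0 ≤ δ)
    (hMδ : M * δ ≤ 1) (m n : ℕ) :
    P.real (⋂ j ∈ Finset.range m, {ω | ∀ i < n, X i ω ∉ Ioc (a + j * δ) (a + (j + 1) * δ)}ᶜ) *
      (m * (1 - M * δ) ^ n) ≤ 1 := by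
  have hmI : ∀ j : ℕ, MeasurableSet (Ioc (a + j * δ) (a + (j + 1) * δ)) := fun j =>
    measurableSet_Ioc
  have hdisj : ∀ i j : ℕ, i < j → Disjoint (Ioc (a + i * δ) (a + (i + 1) * δ))
      (Ioc (a + j * δ) (a + (j + 1) * δ)) := by
    intro i j hij
    refine Set.disjoint_left.2 fun x hx hy => ?_
    have : (i : ℝ) + 1 ≤ j := by exact_mod_cast hij
    have := mul_le_mul_of_nonneg_right this hδ
    linarith [hx.2, hy.1]
  have hdisj' : ∀ i j : ℕ, i ≠ j → Disjoint (Ioc (a + i * δ) (a + (i + 1) * δ))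
      (Ioc (a + j * δ) (a + (j + 1) * δ)) := by
    intro i j hij
    rcases lt_or_gt_of_ne hij with h | h
    · exact hdisj i j h
    · exact (hdisj j i h).symm
  refine le_trans ?_ (measureReal_iInter_compl_mul_sum_le (P := P) (Finset.range m)
    (E := fun j : ℕ => {ω | ∀ i < n, X i ω ∉ Ioc (a + j * δ) (a + (j + 1) * δ)})
    (fun j => measurableSet_forall_notMem hX (hmI j) n) fun i _ j _ hij => ?_)
  · refine mul_le_mul_of_nonneg_left ?_ measureReal_nonneg
    have : ∀ j ∈ Finset.range m, (1 - M * δ) ^ n ≤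
        P.real {ω | ∀ i < n, X i ω ∉ Ioc (a + j * δ) (a + (j + 1) * δ)} := by
      intro j _
      rw [measureReal_forall_notMem hX hlaw hindep (hmI j)]
      have h1 := hM (a + j * δ) (a + (j + 1) * δ) (by linarith)
      have h2 : a + (j + 1) * δ - (a + j * δ) = δ := by ring
      rw [h2] at h1
      exact pow_le_pow_left₀ (by linarith) (by linarith) n
    simpa using Finset.card_nsmul_le_sum _ _ _ this
  · have he : {ω | ∀ l < n, X l ω ∉ Ioc (a + i * δ) (a + (i + 1) * δ)} ∩
        {ω | ∀ l < n, X l ω ∉ Ioc (a + j * δ) (a + (j + 1) * δ)} =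
        {ω | ∀ l < n, X l ω ∉ Ioc (a + i * δ) (a + (i + 1) * δ) ∪
          Ioc (a + j * δ) (a + (j + 1) * δ)} := by
      ext ω
      simp only [mem_inter_iff, mem_ofPred_eq, mem_union, not_or, forall_and]
    rw [he, measureReal_forall_notMem hX hlaw hindep ((hmI i).union (hmI j)),
      measureReal_forall_notMem hX hlaw hindep (hmI i),
      measureReal_forall_notMem hX hlaw hindep (hmI j), ← mul_pow]
    -- For disjoint cells of masses `p` and `q`, `1 - p - q ≤ (1 - p) * (1 - q)`: this is the
    -- nonpositive correlation.
    refine pow_le_pow_left₀ (sub_nonneg.2 measureReal_le_one) ?_ n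
    rw [measureReal_union (hdisj' i j hij) (hmI j)]
    have := mul_nonneg (measureReal_nonneg (μ := μ) (s := Ioc (a + i * δ) (a + (i + 1) * δ)))
      (measureReal_nonneg (μ := μ) (s := Ioc (a + j * δ) (a + (j + 1) * δ)))
    nlinarith

theorem ae_eventually_exists_gap (hX : ∀ i, Measurable (X i)) (hlaw : ∀ i, P.map (X i) = μ)
    (hindep : iIndepFun X P) {M : ℝ} (hM0 : 0 ≤ M)
    (hM : ∀ s t, s ≤ t → μ.real (Ioc s t) ≤ M * (t - s)) (a : ℝ) {l : ℝ} (hl : 0 < l) :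
    ∃ r : ℝ, 0 < r ∧ ∀ᵐ ω ∂P, ∀ᶠ k : ℕ in atTop, ∃ s, a ≤ s ∧ s + r / 2 ^ k ≤ a + l ∧
      ∀ i < k * 2 ^ k, X i ω ∉ Ioc s (s + r / 2 ^ k) := by
  -- `R > 4 * M * l` makes `M * r ≤ 1/4` for `r = l / R`, and `R > 1` leaves at least `2^k` cells.
  obtain ⟨R, hR⟩ := exists_nat_gt (max 1 (4 * (M * l)))
  have hR1 : (1 : ℝ) < R := (le_max_left _ _).trans_lt hR
  have hR2 : 4 * (M * l) < R := (le_max_right _ _).trans_lt hR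
  have hR0 : (0 : ℝ) < R := by linarith
  have hr : 0 < l / R := div_pos hl hR0
  have hq : M * (l / R) ≤ 1 / 4 := by
    rw [← mul_div_assoc, div_le_iff₀ hR0]
    linarith
  have hq0 : 0 ≤ M * (l / R) := by positivity
  refine ⟨l / R, hr, ?_⟩
  have hbound : ∀ k : ℕ, P (⋂ j ∈ Finset.range (R * 2 ^ k), {ω | ∀ i < k * 2 ^ k,
      X i ω ∉ Ioc (a + j * (l / R / 2 ^ k)) (a + (j + 1) * (l / R / 2 ^ k))}ᶜ) ≤
      ENNReal.ofReal ((2 / 3) ^ k) := by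
    intro k
    have h2 : (1 : ℝ) ≤ 2 ^ k := one_le_pow₀ one_le_two
    have hMδ : M * (l / R / 2 ^ k) ≤ 1 / 4 := by
      rw [← mul_div_assoc]
      exact (div_le_self hq0 h2).trans hq
    have h := measureReal_cells_hit_mul_le hX hlaw hindep hM a
      (δ := l / R / 2 ^ k) (by positivity) (by linarith) (R * 2 ^ k) (k * 2 ^ k)
    -- Bernoulli's inequality bounds each block of `2^k` observations by `1 - M * r ≥ 3/4`; there
    -- are `k` blocks.
    have hpow : (3 / 4 : ℝ) ^ k ≤ (1 - M * (l / R / 2 ^ k)) ^ (k * 2 ^ k) := by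
      rw [mul_comm k, pow_mul]
      refine pow_le_pow_left₀ (by norm_num) ?_ k
      have hb := one_add_mul_le_pow (a := -(M * (l / R / 2 ^ k))) (by linarith) (2 ^ k)
      have e : ((2 ^ k : ℕ) : ℝ) * -(M * (l / R / 2 ^ k)) = -(M * (l / R)) := by
        push_cast
        field_simp
      rw [e, ← sub_eq_add_neg, ← sub_eq_add_neg] at hb
      linarith
    have hsum : (3 / 2 : ℝ) ^ k ≤
        ((R * 2 ^ k : ℕ) : ℝ) * (1 - M * (l / R / 2 ^ k)) ^ (k * 2 ^ k) := by
      calc (3 / 2 : ℝ) ^ k = (1 * 2 ^ k) * (3 / 4) ^ k := by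
            rw [one_mul, ← mul_pow]
            norm_num
        _ ≤ _ := by
            push_cast
            gcongr
    rw [ENNReal.le_ofReal_iff_toReal_le (measure_ne_top _ _) (by positivity), ← measureReal_def]
    have h3 := (mul_le_mul_of_nonneg_left hsum measureReal_nonneg).trans h
    have e : (2 / 3 : ℝ) ^ k = 1 / (3 / 2) ^ k := by
      rw [one_div, ← inv_pow]
      norm_num
    rw [e, le_div_iff₀ (by positivity)]
    exact h3
  have hsummable : ∑' k : ℕ, P (⋂ j ∈ Finset.range (R * 2 ^ k), {ω | ∀ i < k * 2 ^ k,
      X i ω ∉ Ioc (a + j * (l / R / 2 ^ k)) (a + (j + 1) * (l / R / 2 ^ k))}ᶜ) ≠ ∞ := by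
    refine ne_top_of_le_ne_top ?_ (ENNReal.tsum_le_tsum hbound)
    exact (summable_geometric_of_lt_one (by norm_num) (by norm_num)).tsum_ofReal_ne_top
  filter_upwards [ae_eventually_notMem hsummable] with ω hω
  filter_upwards [hω] with k hk
  simp only [mem_iInter, Finset.mem_range, not_forall, mem_compl_iff, not_not] at hk
  obtain ⟨j, hj, hjω⟩ := hk
  have hd : 0 < l / R / 2 ^ k := by positivity
  have e : a + j * (l / R / 2 ^ k) + l / R / 2 ^ k = a + (j + 1) * (l / R / 2 ^ k) := by ring
  refine ⟨a + j * (l / R / 2 ^ k), ?_, ?_, ?_⟩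
  · have : 0 ≤ j * (l / R / 2 ^ k) := by positivity
    linarith
  · rw [e]
    have hj' : (j : ℝ) + 1 ≤ R * 2 ^ k := by exact_mod_cast hj
    have h1 := mul_le_mul_of_nonneg_right hj' hd.le
    have h2 : (R : ℝ) * 2 ^ k * (l / R / 2 ^ k) = l := by field_simp
    linarith
  · rw [e]
    exact hjω

theorem ae_eventually_log_le_lowerK (hX : ∀ i, Measurable (X i)) (hlaw : ∀ i, P.map (X i) = μ)
    (hindep : iIndepFun X P) {M : ℝ} (hM0 : 0 ≤ M)
    (hM : ∀ s t, s ≤ t → μ.real (Ioc s t) ≤ M * (t - s)) {a b : ℝ} (hab : a < b)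
    (ha : 0 < μ (Iio a)) (hb : 0 < μ (Ioi b)) :
    ∃ c : ℝ, 0 < c ∧ ∀ᵐ ω ∂P, ∀ᶠ n : ℕ in atTop, c * Real.log n ≤ lowerK (sample X n ω) := by
  obtain ⟨r, hr, hgap⟩ := ae_eventually_exists_gap hX hlaw hindep hM0 hM a (sub_pos.2 hab)
  refine ⟨r / 8, by positivity, ?_⟩
  filter_upwards [hgap, ae_exists_mem hX hlaw hindep measurableSet_Iio ha,
    ae_exists_mem hX hlaw hindep measurableSet_Ioi hb] with ω hgap ⟨il, hil⟩ ⟨ir, hir⟩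
  obtain ⟨k₀, hk₀⟩ := eventually_atTop.1 hgap
  filter_upwards [eventually_gt_atTop (max il ir), eventually_gt_atTop ((k₀ + 2) * 2 ^ (k₀ + 2))]
    with n hn1 hn2
  have hil' : il < n := (le_max_left _ _).trans_lt hn1
  have hir' : ir < n := (le_max_right _ _).trans_lt hn1
  -- This selects `k` with `k * 2^k < n ≤ (k+1) * 2^(k+1)`. The cell missed at stage `k + 1` is then
  -- missed by the first `n` observations.
  have hex : ∃ k, n ≤ (k + 1) * 2 ^ (k + 1) :=
    ⟨n, by nlinarith [Nat.one_le_two_pow (n := n + 1)]⟩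
  obtain ⟨k, hk⟩ : ∃ k, Nat.find hex = k := ⟨_, rfl⟩
  have hnk : n ≤ (k + 1) * 2 ^ (k + 1) := hk ▸ Nat.find_spec hex
  have hkk : k₀ + 2 ≤ k := by
    by_contra! h
    have : (k + 1) * 2 ^ (k + 1) ≤ (k₀ + 2) * 2 ^ (k₀ + 2) :=
      Nat.mul_le_mul (by omega) (Nat.pow_le_pow_right (by norm_num) (by omega))
    omega
  have hlow : k * 2 ^ k < n := by
    have := Nat.find_min hex (m := k - 1) (by omega)
    rw [Nat.sub_add_cancel (by omega)] at this
    omega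
  obtain ⟨s, hs1, hs2, hs3⟩ := hk₀ (k + 1) (by omega)
  have hd : 0 < r / 2 ^ (k + 1) := by positivity
  have hmain := mul_gap_le_lowerK (sample X n ω) (s := s) (t := s + r / 2 ^ (k + 1))
    ⟨⟨il, hil'⟩, (le_of_lt hil).trans hs1⟩
    ⟨⟨ir, hir'⟩, lt_of_le_of_lt (by linarith) hir⟩ (by linarith)
    fun i => hs3 i (i.2.trans_le hnk)
  rw [add_sub_cancel_left] at hmain
  refine le_trans ?_ hmain
  have hlog : Real.log n ≤ 2 * (k + 1) := by
    have h4 : (n : ℝ) ≤ 4 ^ (k + 1) := by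
      have : n ≤ 4 ^ (k + 1) := by
        refine hnk.trans ?_
        rw [show 4 = 2 * 2 from rfl, mul_pow]
        exact Nat.mul_le_mul Nat.lt_two_pow_self.le le_rfl
      exact_mod_cast this
    have h5 : Real.log (4 ^ (k + 1)) = (k + 1) * (2 * Real.log 2) := by
      rw [Real.log_pow, show (4 : ℝ) = 2 ^ 2 by norm_num, Real.log_pow]
      push_cast
      ring
    have h6 : Real.log 2 ≤ 1 := by linarith [Real.log_two_lt_d9]
    have := Real.log_le_log (by exact_mod_cast (by omega : 0 < n)) h4
    rw [h5] at this
    have hk1 : (0 : ℝ) ≤ k + 1 := by positivity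
    nlinarith
  have hn : (k : ℝ) * 2 ^ k ≤ n := by exact_mod_cast hlow.le
  have hk1 : (1 : ℝ) ≤ k := by exact_mod_cast (by omega : 1 ≤ k)
  -- The `8` combines `log n ≤ 2 * (k + 1) ≤ 4 * k` with the factor `2` lost between `2^k` and
  -- `2^(k+1)`.
  calc r / 8 * Real.log n ≤ r / 8 * (2 * (k + 1)) := by gcongr
    _ ≤ r / 8 * (4 * k) := mul_le_mul_of_nonneg_left (by linarith) (by positivity)
    _ = (k * 2 ^ k) * (r / 2 ^ (k + 1)) := by
        rw [pow_succ]
        field_simp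
        norm_num
    _ ≤ n * (r / 2 ^ (k + 1)) := by gcongr

end gaps

theorem HasNiceDensity.exists_measureReal_Ioc_le {μ : Measure ℝ} {A B : ℝ}
    (h : HasNiceDensity μ A B) :
    ∃ M : ℝ, 0 ≤ M ∧ ∀ s t, s ≤ t → μ.real (Ioc s t) ≤ M * (t - s) := by
  obtain ⟨f, hμ, -, hf, -⟩ := h
  obtain ⟨M, hM⟩ := isCompact_Icc.bddAbove_image hf.continuousOn
  refine ⟨max M 0, le_max_right _ _, fun s t hst => ?_⟩
  refine ENNReal.toReal_le_of_le_ofReal (mul_nonneg (le_max_right _ _) (sub_nonneg.2 hst)) ?_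
  rw [hμ, withDensity_apply _ measurableSet_Ioc]
  calc ∫⁻ x in Ioc s t, ENNReal.ofReal (f x) ∂(volume.restrict (Icc A B))
      ≤ ∫⁻ _ in Ioc s t, ENNReal.ofReal (max M 0) ∂(volume.restrict (Icc A B)) := by
        refine lintegral_mono_ae (ae_restrict_of_ae ?_)
        filter_upwards [ae_restrict_mem measurableSet_Icc] with x hx
        exact ENNReal.ofReal_le_ofReal ((hM (mem_image_of_mem f hx)).trans (le_max_left _ _))
    _ ≤ ENNReal.ofReal (max M 0) * volume (Ioc s t) := by
        rw [setLIntegral_const]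
        gcongr
        exact Measure.restrict_le_self
    _ = ENNReal.ofReal (max M 0 * (t - s)) := by
        rw [Real.volume_Ioc, ENNReal.ofReal_mul (le_max_right _ _)]

end WGAN

theorem mainTheorem7 {Ω : Type*} [MeasurableSpace Ω] (P : Measure Ω) [IsProbabilityMeasure P]
    (μ : Measure ℝ) [IsProbabilityMeasure μ] (X : ℕ → Ω → ℝ)
    (hX : ∀ i, Measurable (X i)) (hlaw : ∀ i, P.map (X i) = μ) (hindep : iIndepFun X P)
    (A B : ℝ) (hAB : A < B) (hsupp : μ.support = Icc A B) :
    (WGAN.HasNiceDensity μ A B →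
      ∃ C : ℝ, ∀ᵐ ω ∂P, ∀ᶠ n : ℕ in atTop,
        0 < WGAN.lowerK (WGAN.sample X n ω) ∧
        1 / WGAN.lowerK (WGAN.sample X n ω) ≤ C * (Real.log n)⁻¹) ∧
    (∀ K : ℕ → Ω → ℝ,
      (∀ n, 1 ≤ n → ∀ᵐ ω ∂P, WGAN.lowerK (WGAN.sample X n ω) ≤ K n ω) →
      WGAN.BigOInProb P
        (fun n ω => WGAN.W1 (WGAN.pushUniform (WGAN.gStar (WGAN.sample X n ω) (K n ω))) μ)
        (fun n => (n : ℝ) ^ (-(1 / 2) : ℝ))) := by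
  refine ⟨fun hden => ?_, fun K hK => ?_⟩
  · obtain ⟨M, hM0, hM⟩ := hden.exists_measureReal_Ioc_le
    -- `A` and `B` belong to the support, so their neighbourhoods are charged; the quarter points
    -- leave a nondegenerate interval between them for the cells.
    have hA : 0 < μ (Iio (A + (B - A) / 4)) := by
      refine (Measure.mem_support_iff_forall A).1 ?_ _ (Iio_mem_nhds (by linarith))
      exact hsupp ▸ left_mem_Icc.2 hAB.le
    have hB : 0 < μ (Ioi (B - (B - A) / 4)) := by
      refine (Measure.mem_support_iff_forall B).1 ?_ _ (Ioi_mem_nhds (by linarith))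
      exact hsupp ▸ right_mem_Icc.2 hAB.le
    obtain ⟨c, hc, h⟩ := WGAN.ae_eventually_log_le_lowerK hX hlaw hindep hM0 hM
      (by linarith) hA hB
    refine ⟨c⁻¹, ?_⟩
    filter_upwards [h] with ω hω
    filter_upwards [hω, eventually_ge_atTop 2] with n hn hn2
    have hlog : 0 < Real.log n := Real.log_pos (by exact_mod_cast hn2)
    have hpos : 0 < c * Real.log n := mul_pos hc hlog
    refine ⟨hpos.trans_le hn, ?_⟩
    rw [← mul_inv, ← one_div]
    exact one_div_le_one_div_of_le hpos hn
  · refine WGAN.bigOInProb_W1_gStar hX hlaw hindep hAB ?_ K hK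
    rw [← hsupp]
    exact Measure.measure_compl_support
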